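/- For $n\ge 1$ let $\mathrm{O}(n)=\{M\in M_n(\mathbb C): M^{\mathrm{tr}}M=MM^{\mathrm{tr}}=I_n\}$ be the complex orthogonal group, $\mathrm{SO}(n)=\{M\in \mathrm{O}(n):\det M=1\}$, and let $\mathrm{PO}(n)=\mathrm{O}(n)/\{\pm I_n\}$ be the projective complex orthogonal group, with quotient map $q_n:\mathrm{O}(n)\to\mathrm{PO}(n)$. All homotopy groups are based at the identity. For $k\le N$ let $s:\mathrm{O}(k)\to\mathrm{O}(N)$ be the stabilization map $s(A)=\mathrm{diag}(A,I_{N-k})$. Let $m$ and $n$ be positive integers with $m$ even and $n$ odd, and let $i>1$. The Kronecker product of matrices induces a map $\otimes:\mathrm{PO}(m)\times\mathrm{SO}(n)\to\mathrm{PO}(mn)$, $([A],B)\mapsto[A\otimes B]$. The homomorphisms $(q_m)_*:\pi_i(\mathrm{O}(m))\to\pi_i(\mathrm{PO}(m))$ and $(q_{mn})_*:\pi_i(\mathrm{O}(mn))\to\pi_i(\mathrm{PO}(mn))$ are isomorphisms. Write $$\mathrm{stab}=(q_{mn})_*\circ s_*\circ (q_m)_*^{-1}:\pi_i(\mathrm{PO}(m))\to\pi_i(\mathrm{PO}(mn))$$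 and, with $j:\mathrm{SO}(n)\hookrightarrow \mathrm{O}(n)$ the inclusion, $$\mathrm{stab}=(q_{mn})_*\circ s_*\circ j_*:\pi_i(\mathrm{SO}(n))\to\pi_i(\mathrm{PO}(mn)).$$ Then the homomorphism $$\otimes_*:\pi_i(\mathrm{PO}(m))\times\pi_i(\mathrm{SO}(n))\to\pi_i(\mathrm{PO}(mn))$$ induced by $\otimes$ is given by $$\otimes_*(x,y)=n\,\mathrm{stab}(x)+m\,\mathrm{stab}(y)\qquad\text{for all }x\in\pi_i(\mathrm{PO}(m)),\ y\in\pi_i(\mathrm{SO}(n)).$$ -/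

import Mathlib

open scoped Topology Topology.Homotopy Kronecker

noncomputable section

namespace HomotopyGroup

variable {N X Y : Type*} [TopologicalSpace X] [TopologicalSpace Y] {x : X} {y : Y}

/-- The generalized loop `f ∘ p`, for a continuous map `f` with `f x = y`. -/
def mapLoop (f : C(X, Y)) (hf : f x = y) (p : Ω^ N X x) : Ω^ N Y y :=
  ⟨f.comp p.1, fun t ht => by
    have h : p.1 t = x := p.2 t ht
    simp [h, hf]⟩

/-- The homomorphism `f_* : π_N(X, x) → π_N(Y, y)` induced by a continuous map `f` with
`f x = y`; it sends the class of `p` to the class of `f ∘ p`. -/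
def map (N : Type*) [DecidableEq N] [Nonempty N] (f : C(X, Y)) (hf : f x = y) :
    HomotopyGroup N X x →* HomotopyGroup N Y y :=
  MonoidHom.mk'
    (Quotient.map (mapLoop f hf) fun _ _ h =>
      Nonempty.map (fun H => H.compContinuousMap f) h)
    (by
      rintro ⟨p⟩ ⟨q⟩
      have e := mul_spec (i := Classical.arbitrary N) (p := p) (q := q)
      have e' := mul_spec (i := Classical.arbitrary N) (p := mapLoop f hf p)
        (q := mapLoop f hf q)
      refine (congrArg _ e).trans (Eq.trans ?_ e'.symm)
      refine congrArg (Quotient.mk _) ?_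
      ext t
      change f (GenLoop.transAt _ q p t) = _
      simp only [GenLoop.transAt, GenLoop.coe_copy]
      split_ifs <;> rfl)

/-- The generalized loop `t ↦ (p t, q t)` in a product. -/
def prodLoop (p : Ω^ N X x) (q : Ω^ N Y y) : Ω^ N (X × Y) (x, y) :=
  ⟨p.1.prodMk q.1, fun t ht => Prod.ext (p.2 t ht) (q.2 t ht)⟩

/-- The standard isomorphism `π_N(X × Y, (x, y)) ≅ π_N(X, x) × π_N(Y, y)` induced by the two
projections; its inverse sends the classes of `p` and `q` to the class of `t ↦ (p t, q t)`. -/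
def prodEquiv (N : Type*) [DecidableEq N] [Nonempty N] (x : X) (y : Y) :
    HomotopyGroup N (X × Y) (x, y) ≃* HomotopyGroup N X x × HomotopyGroup N Y y where
  toFun c := (map N ContinuousMap.fst rfl c, map N ContinuousMap.snd rfl c)
  invFun a := Quotient.map₂ prodLoop
    (fun _ _ h _ _ h' =>
      Nonempty.elim h fun H => Nonempty.map (fun H' => ContinuousMap.HomotopyRel.prod H H') h')
    a.1 a.2
  left_inv := by
    rintro ⟨p⟩
    rfl
  right_inv := by
    rintro ⟨⟨p⟩, ⟨q⟩⟩
    rfl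
  map_mul' a b := by
    simp only [map_mul]
    rfl

end HomotopyGroup

namespace ComplexOrthogonal

/-- The complex orthogonal group `O(n)` of the complex `n × n` matrices `M` with
`Mᵀ * M = M * Mᵀ = 1` (transpose, without conjugation), with the subspace topology. -/
abbrev O (n : ℕ) : Type := Matrix.orthogonalGroup (Fin n) ℂ

/-- The complex special orthogonal group `SO(n)`: the `M` in `O(n)` with `det M = 1`. -/
abbrev SO (n : ℕ) : Type := Matrix.specialOrthogonalGroup (Fin n) ℂ

/-- The inclusion of `SO(n)` into `O(n)`. -/
def incl (n : ℕ) : C(SO n, O n) :=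
  ⟨fun B => ⟨B.1, B.2.1⟩, by fun_prop⟩

/-- The subgroup `{1, -1}` of `O(n)`. -/
def signs (n : ℕ) : Subgroup (O n) where
  carrier := {A | A.1 = 1 ∨ A.1 = -1}
  one_mem' := Or.inl rfl
  mul_mem' := by
    rintro A B (hA | hA) (hB | hB) <;>
      simp only [Set.mem_ofPred_eq, Submonoid.coe_mul, hA, hB] <;> simp
  inv_mem' := by
    rintro A (hA | hA)
    · left
      change A.1.transpose = 1
      simp [hA]
    · right
      change A.1.transpose = -1
      simp [hA]

instance (n : ℕ) : (signs n).Normal where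
  conj_mem := by
    rintro A (hA | hA) B
    · have h : A = 1 := Subtype.ext hA
      exact Or.inl (by simp [h])
    · right
      have h : B.1 * (B⁻¹).1 = 1 := congrArg Subtype.val (mul_inv_cancel B)
      change B.1 * A.1 * (B⁻¹).1 = -1
      rw [hA, mul_neg, mul_one, neg_mul, h]

/-- The projective complex orthogonal group `PO(n) = O(n) / {1, -1}`, with the quotient
topology. -/
abbrev PO (n : ℕ) : Type := O n ⧸ signs n

/-- The quotient map `O(n) → PO(n)`. -/
def quot (n : ℕ) : C(O n, PO n) :=
  ⟨fun A => (A : PO n), continuous_quotient_mk'⟩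

/-- The Kronecker product `A ⊗ B` of two orthogonal matrices, an `mn × mn` matrix; its entry at
`(i * n + k, j * n + l)` is `A i j * B k l`. -/
def kron {m n : ℕ} (A : O m) (B : O n) : O (m * n) :=
  ⟨Matrix.reindex finProdFinEquiv finProdFinEquiv (A.1 ⊗ₖ B.1), by
    have hA := (Matrix.mem_orthogonalGroup_iff _ _).1 A.2
    have hB := (Matrix.mem_orthogonalGroup_iff _ _).1 B.2
    rw [Matrix.mem_orthogonalGroup_iff]
    have hT : (A.1 ⊗ₖ B.1).transpose = A.1.transpose ⊗ₖ B.1.transpose := rfl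
    rw [Matrix.reindex_apply, Matrix.transpose_submatrix, Matrix.submatrix_mul_equiv, hT,
      ← Matrix.mul_kronecker_mul, hA, hB, Matrix.one_kronecker_one, Matrix.submatrix_one_equiv]⟩

theorem continuous_kron (m n : ℕ) : Continuous fun p : O m × O n => kron p.1 p.2 := by
  refine Continuous.subtype_mk ?_ _
  refine continuous_matrix fun i j => ?_
  simp only [Matrix.reindex_apply, Matrix.submatrix_apply, Matrix.kroneckerMap_apply]
  exact ((continuous_subtype_val.comp continuous_fst).matrix_elem _ _).mul
    ((continuous_subtype_val.comp continuous_snd).matrix_elem _ _)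

theorem quot_kron_eq {m n : ℕ} {A A' : O m} (B : O n) (h : quot m A = quot m A') :
    quot (m * n) (kron A B) = quot (m * n) (kron A' B) := by
  have key : A'.1 = A.1 ∨ A'.1 = -A.1 := by
    have h1 : (A⁻¹ * A').1 = 1 ∨ (A⁻¹ * A').1 = -1 := QuotientGroup.eq.1 h
    have h2 : A'.1 = A.1 * (A⁻¹ * A').1 := by
      have := congrArg Subtype.val (mul_inv_cancel_left A A')
      exact this.symm
    rcases h1 with h1 | h1 <;> rw [h1] at h2 <;> simp_all
  rcases key with e | e
  · rw [Subtype.ext e]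
  · refine QuotientGroup.eq.2 (Or.inr ?_)
    have h3 : (kron A' B).1 = -(kron A B).1 := by
      ext i j
      simp [kron, e]
    have h4 : ((kron A B)⁻¹).1 * (kron A B).1 = 1 :=
      congrArg Subtype.val (inv_mul_cancel (kron A B))
    change ((kron A B)⁻¹).1 * (kron A' B).1 = -1
    rw [h3, mul_neg, h4]

/-- The tensor product `PO(m) × SO(n) → PO(mn)`, `([A], B) ↦ [A ⊗ B]`. -/
def tensor (m n : ℕ) : C(PO m × SO n, PO (m * n)) where
  toFun p := Quotient.liftOn p.1 (fun A => quot (m * n) (kron A (incl n p.2)))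
    fun _ _ h => quot_kron_eq _ (Quotient.sound h)
  continuous_toFun := by
    have hq : IsOpenQuotientMap (Prod.map (quot m) (id : SO n → SO n)) :=
      IsOpenQuotientMap.prodMap QuotientGroup.isOpenQuotientMap_mk .id
    refine hq.isQuotientMap.continuous_iff.2 ?_
    exact (quot (m * n)).continuous.comp ((continuous_kron m n).comp
      (continuous_fst.prodMk ((incl n).continuous.comp continuous_snd)))

theorem tensor_one (m n : ℕ) : tensor m n (1, 1) = 1 := by
  refine congrArg (quot (m * n)) (Subtype.ext ?_)
  change Matrix.reindex _ _ ((1 : Matrix (Fin m) (Fin m) ℂ) ⊗ₖ (1 : Matrix (Fin n) (Fin n) ℂ)) = 1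
  simp

/-- The bijection `Fin k ⊕ Fin (N - k) ≃ Fin N` which lists `Fin k` first. -/
def blockEquiv {k N : ℕ} (h : k ≤ N) : Fin k ⊕ Fin (N - k) ≃ Fin N :=
  finSumFinEquiv.trans (finCongr (Nat.add_sub_of_le h))

/-- The stabilization map `O(k) → O(N)`, `A ↦ diag(A, 1)`, for `k ≤ N`. -/
def stabMap {k N : ℕ} (h : k ≤ N) : C(O k, O N) where
  toFun A := ⟨Matrix.reindex (blockEquiv h) (blockEquiv h) (Matrix.fromBlocks A.1 0 0 1), by
    have hA := (Matrix.mem_orthogonalGroup_iff _ _).1 A.2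
    rw [Matrix.mem_orthogonalGroup_iff]
    simp [Matrix.fromBlocks_transpose, Matrix.fromBlocks_multiply, hA]⟩
  continuous_toFun := by
    refine Continuous.subtype_mk ?_ _
    exact (Continuous.matrix_fromBlocks continuous_subtype_val continuous_const continuous_const
      continuous_const).matrix_reindex _ _

theorem stabMap_one {k N : ℕ} (h : k ≤ N) : stabMap h 1 = 1 := by
  refine Subtype.ext ?_
  change Matrix.reindex _ _ (Matrix.fromBlocks (1 : Matrix (Fin k) (Fin k) ℂ) 0 0 1) = 1
  simp

/-- The `i`-th homotopy group of `O(n)`, based at the identity. -/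
abbrev piO (i n : ℕ) : Type := π_ i (O n) 1

/-- The `i`-th homotopy group of `SO(n)`, based at the identity. -/
abbrev piSO (i n : ℕ) : Type := π_ i (SO n) 1

/-- The `i`-th homotopy group of `PO(n)`, based at the identity. -/
abbrev piPO (i n : ℕ) : Type := π_ i (PO n) 1

section

variable (i : ℕ) [Nonempty (Fin i)]

/-- The homomorphism `π_i(O(n)) → π_i(PO(n))` induced by the quotient map. -/
def quotPi (n : ℕ) : piO i n →* piPO i n :=
  HomotopyGroup.map (Fin i) (quot n) rfl

/-- The homomorphism `π_i(O(k)) → π_i(O(N))` induced by `A ↦ diag(A, 1)`. -/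
def stabO {k N : ℕ} (h : k ≤ N) : piO i k →* piO i N :=
  HomotopyGroup.map (Fin i) (stabMap h) (stabMap_one h)

/-- The stabilization `π_i(SO(k)) → π_i(O(k)) → π_i(O(N)) → π_i(PO(N))`. -/
def stabSO {k N : ℕ} (h : k ≤ N) : piSO i k →* piPO i N :=
  (quotPi i N).comp ((stabO i h).comp (HomotopyGroup.map (Fin i) (incl k) rfl))

/-- The stabilization `π_i(PO(k)) ≅ π_i(O(k)) → π_i(O(N)) → π_i(PO(N))`, where the first map is the
inverse of the homomorphism induced by the quotient map, provided that the latter is bijective.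
(There is no map `PO(k) → PO(N)` that sends `[A]` to `[diag(A, 1)]`.) -/
def stabPO {k N : ℕ} (h : k ≤ N) (hq : Function.Bijective (quotPi i k)) : piPO i k →* piPO i N :=
  (quotPi i N).comp ((stabO i h).comp (MulEquiv.ofBijective (quotPi i k) hq).symm.toMonoidHom)

/-- The homomorphism `π_i(PO(m)) × π_i(SO(n)) ≅ π_i(PO(m) × SO(n)) → π_i(PO(mn))` induced by the
tensor product. -/
def tensorPi (m n : ℕ) : piPO i m × piSO i n →* piPO i (m * n) :=
  (HomotopyGroup.map (Fin i) (tensor m n) (tensor_one m n)).comp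
    (HomotopyGroup.prodEquiv (Fin i) (1 : PO m) (1 : SO n)).symm.toMonoidHom

end

end ComplexOrthogonal

end

namespace Cube

variable {N : Type*}

theorem isPreconnected_face (i : N) (c : unitInterval) :
    IsPreconnected {y : N → unitInterval | y i = c} := by
  classical
  have h : {y : N → unitInterval | y i = c} =
      Set.range fun y : N → unitInterval => Function.update y i c := by
    ext y
    refine ⟨fun hy => ⟨y, ?_⟩, ?_⟩
    · obtain rfl : y i = c := hy
      exact Function.update_eq_self i y
    · rintro ⟨z, rfl⟩
      simp
  rw [h]
  exact isPreconnected_range (continuous_id.update i continuous_const)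

theorem zero_mem_boundary [Nonempty N] : (0 : N → unitInterval) ∈ boundary N :=
  ⟨Classical.arbitrary N, Or.inl rfl⟩

/-- The boundary of a cube of dimension at least two is connected. -/
theorem isPreconnected_boundary [Nontrivial N] : IsPreconnected (boundary N) := by
  classical
  refine isPreconnected_of_forall 0 ?_
  rintro y ⟨i, hy | hy⟩
  · exact ⟨{z | z i = 0}, fun z hz => ⟨i, Or.inl hz⟩, rfl, hy, isPreconnected_face i 0⟩
  · obtain ⟨j, hj⟩ := exists_ne i
    refine ⟨{z | z j = 0} ∪ {z | z i = 1}, ?_, Or.inl rfl, Or.inr hy, ?_⟩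
    · rintro z (hz | hz)
      exacts [⟨j, Or.inl hz⟩, ⟨i, Or.inr hz⟩]
    · refine (isPreconnected_face j 0).union (Function.update (0 : N → unitInterval) i 1) ?_ ?_
        (isPreconnected_face i 1)
      · simp [Function.update_of_ne hj]
      · simp

end Cube

namespace HomotopyGroup

section

variable {X Y : Type*} [TopologicalSpace X] [TopologicalSpace Y] {x : X} {y : Y}
  (N : Type*) [DecidableEq N] [Nonempty N]

theorem map_const (c : HomotopyGroup N X x) :
    map N (ContinuousMap.const X y) rfl c = 1 := by
  obtain ⟨p⟩ := c
  rfl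

/-- Maps which are homotopic relative to the base point induce the same homomorphism. -/
theorem map_eq_of_homotopicRel {f g : C(X, Y)} (hf : f x = y) (hg : g x = y)
    (h : f.HomotopicRel g {x}) (c : HomotopyGroup N X x) : map N f hf c = map N g hg c := by
  obtain ⟨p⟩ := c
  obtain ⟨H⟩ := h
  refine Quotient.sound ⟨⟨⟨⟨fun a => H (a.1, p a.2), by fun_prop⟩, ?_, ?_⟩, ?_⟩⟩
  · intro t
    exact H.apply_zero _
  · intro t
    exact H.apply_one _
  · intro a t ht
    exact H.eq_fst a (p.2 t ht)

variable {G : Type*} [Monoid G] [TopologicalSpace G] [ContinuousMul G]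

/-- The pointwise product of maps into a topological monoid induces the product of the induced
homomorphisms. -/
theorem map_mul_apply (f g : C(X, G)) (hf : f x = 1) (hg : g x = 1)
    (c : HomotopyGroup N X x) :
    map N (f * g) (by simp [hf, hg]) c = map N f hf c * map N g hg c := by
  let μ : C(G × G, G) := ⟨fun a => a.1 * a.2, continuous_mul⟩
  have hμ : μ (1, 1) = 1 := mul_one 1
  let e := (prodEquiv N (1 : G) (1 : G)).symm
  have h1 (a : HomotopyGroup N G 1) : map N μ hμ (e (a, 1)) = a := by
    obtain ⟨p⟩ := a
    refine congrArg (Quotient.mk _) ?_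
    ext t
    exact mul_one _
  have h2 (a : HomotopyGroup N G 1) : map N μ hμ (e (1, a)) = a := by
    obtain ⟨p⟩ := a
    refine congrArg (Quotient.mk _) ?_
    ext t
    exact one_mul _
  have h3 : map N (f * g) (by simp [hf, hg]) c = map N μ hμ (e (map N f hf c, map N g hg c)) := by
    obtain ⟨p⟩ := c
    rfl
  have h4 : (map N f hf c, map N g hg c) = (map N f hf c, 1) * (1, map N g hg c) := by simp
  rw [h3, h4, map_mul, map_mul, h1, h2]

theorem map_list_prod {ι : Type*} (l : List ι) (f : ι → C(X, G)) (hf : ∀ a ∈ l, f a x = 1)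
    (h1 : (l.map f).prod x = 1) (c : HomotopyGroup N X x) (b : HomotopyGroup N G 1)
    (hb : ∀ a (ha : a ∈ l), map N (f a) (hf a ha) c = b) :
    map N (l.map f).prod h1 c = b ^ l.length := by
  induction l with
  | nil => exact map_const N c
  | cons a l ih =>
    have ha : f a x = 1 := hf a (by simp)
    have hl : (l.map f).prod x = 1 := by simpa [ha] using h1
    rw [List.length_cons, pow_succ',
      ← ih (fun i hi => hf i (by simp [hi])) hl fun i hi => hb i (by simp [hi]),
      ← hb a (by simp)]
    exact map_mul_apply N (f a) (l.map f).prod ha hl c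

/-- A covering map induces isomorphisms of the homotopy groups in degrees at least two. -/
theorem map_bijective_of_isCoveringMap {N : Type*} [DecidableEq N] [Nontrivial N]
    (f : C(X, Y)) (hf : f x = y) (cov : IsCoveringMap f) :
    Function.Bijective (map N f hf) := by
  constructor
  · rintro ⟨p⟩ ⟨q⟩ h
    obtain h : (f.comp p.1).HomotopicRel (f.comp q.1) (Cube.boundary N) := Quotient.exact h
    refine Quotient.sound ((cov.homotopicRel_iff_comp ⟨0, Cube.zero_mem_boundary, ?_⟩).2 h)
    exact (p.2 0 Cube.zero_mem_boundary).trans (q.2 0 Cube.zero_mem_boundary).symm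
  · rintro ⟨p⟩
    let H : C(unitInterval × (N → unitInterval), Y) :=
      ⟨fun a => p fun j => a.1 * a.2 j, by fun_prop⟩
    have p0 : p 0 = y := p.2 0 Cube.zero_mem_boundary
    have H0 (t : N → unitInterval) : H (0, t) = f (ContinuousMap.const (N → unitInterval) x t) := by
      change p (fun j => 0 * t j) = f x
      rw [hf]
      refine Eq.trans (congrArg p ?_) p0
      ext j
      simp
    let L := cov.liftHomotopy H (ContinuousMap.const _ x) H0
    let q : C(N → unitInterval, X) := ⟨fun t => L (1, t), by fun_prop⟩
    have hq (t : N → unitInterval) : f (q t) = p t := by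
      have : f (L (1, t)) = H (1, t) := congrFun (cov.liftHomotopy_lifts H _ H0) (1, t)
      refine this.trans ?_
      change p (fun j => 1 * t j) = p t
      simp
    have q0 : q 0 = x := by
      have h := cov.const_of_comp (g := fun s : unitInterval => L (s, 0)) (by fun_prop)
          (fun s s' => by
        have e (s : unitInterval) : f (L (s, 0)) = p 0 := by
          refine (congrFun (cov.liftHomotopy_lifts H _ H0) (s, 0)).trans ?_
          change p (fun j => s * 0) = p 0
          simp only [mul_zero]
          rfl
        exact (e s).trans (e s').symm) 1 0
      exact h.trans (cov.liftHomotopy_zero H (ContinuousMap.const _ x) H0 0)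
    refine ⟨Quotient.mk _ ⟨q, fun t ht => ?_⟩, ?_⟩
    · rw [← q0]
      refine cov.constOn_of_comp Cube.isPreconnected_boundary q.continuous.continuousOn
        (fun a ha b hb => ?_) ht Cube.zero_mem_boundary
      rw [hq, hq]
      exact (p.2 a ha).trans (p.2 b hb).symm
    · refine congrArg (Quotient.mk _) ?_
      ext t
      exact hq t

end

end HomotopyGroup

noncomputable section

namespace ComplexOrthogonal

open Matrix

instance (n : ℕ) : IsTopologicalGroup (O n) where
  continuous_inv := Continuous.subtype_mk continuous_subtype_val.matrix_transpose _

theorem finite_signs (n : ℕ) : (signs n : Set (O n)).Finite := by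
  have h : ({1, -1} : Set (Matrix (Fin n) (Fin n) ℂ)).Finite := by simp
  refine (h.preimage Subtype.val_injective.injOn).subset ?_
  rintro A (hA | hA)
  exacts [Or.inl hA, Or.inr hA]

theorem isCoveringMap_quot (n : ℕ) : IsCoveringMap (quot n) := by
  have hd : DiscreteTopology (signs n : Set (O n)) :=
    have := (finite_signs n).to_subtype
    inferInstance
  exact ((signs n).isQuotientCoveringMap ⟨hd⟩).isCoveringMap

theorem quotPi_bijective (i n : ℕ) [Nontrivial (Fin i)] : Function.Bijective (quotPi i n) :=
  HomotopyGroup.map_bijective_of_isCoveringMap (quot n) rfl (isCoveringMap_quot n)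

variable {k N : ℕ}

theorem frame_mem {V : Matrix (Fin N) (Fin k) ℂ} (hV : Vᵀ * V = 1) (A : O k) :
    1 + V * (A.1 - 1) * Vᵀ ∈ orthogonalGroup (Fin N) ℂ := by
  have hA := (mem_orthogonalGroup_iff _ _).1 A.2
  rw [mem_orthogonalGroup_iff]
  have h : V * (A.1 - 1) * Vᵀ * (V * (A.1ᵀ - 1) * Vᵀ) =
      V * ((A.1 - 1) * (A.1ᵀ - 1)) * Vᵀ := by
    calc _ = V * (A.1 - 1) * (Vᵀ * V) * (A.1ᵀ - 1) * Vᵀ := by simp only [Matrix.mul_assoc]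
      _ = _ := by rw [hV]; simp only [Matrix.mul_assoc, Matrix.mul_one]
  simp only [transpose_add, transpose_mul, transpose_one, transpose_transpose, transpose_sub]
  rw [← Matrix.mul_assoc V, add_mul, mul_add, mul_add, h, sub_mul, mul_sub, mul_sub, hA]
  simp only [Matrix.mul_sub, Matrix.sub_mul, Matrix.mul_one, Matrix.one_mul]
  abel

/-- The map `O(k) → O(N)` which lets `A` act on the span of the orthonormal columns of `V`, and
the identity on the orthogonal complement. -/
def frameMap (V : Matrix (Fin N) (Fin k) ℂ) (hV : Vᵀ * V = 1) : C(O k, O N) where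
  toFun A := ⟨1 + V * (A.1 - 1) * Vᵀ, frame_mem hV A⟩
  continuous_toFun := by
    refine Continuous.subtype_mk ?_ _
    fun_prop

theorem frameMap_one (V : Matrix (Fin N) (Fin k) ℂ) (hV : Vᵀ * V = 1) : frameMap V hV 1 = 1 :=
  Subtype.ext (by simp [frameMap])

/-- The homotopy is given by rotating one frame into the other. -/
theorem frameMap_homotopicRel {V W : Matrix (Fin N) (Fin k) ℂ} (hV : Vᵀ * V = 1)
    (hW : Wᵀ * W = 1) (h : Vᵀ * W = 0) :
    (frameMap V hV).HomotopicRel (frameMap W hW) {1} := by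
  have h' : Wᵀ * V = 0 := by simpa using congrArg transpose h
  let c (t : unitInterval) : ℂ := Complex.cos ((t : ℝ) * (Real.pi / 2 : ℝ))
  let s (t : unitInterval) : ℂ := Complex.sin ((t : ℝ) * (Real.pi / 2 : ℝ))
  let F (t : unitInterval) : Matrix (Fin N) (Fin k) ℂ := c t • V + s t • W
  have hF (t : unitInterval) : (F t)ᵀ * F t = 1 := by
    have e : c t * c t + s t * s t = 1 := by
      simpa only [sq] using Complex.cos_sq_add_sin_sq _
    simp only [F, transpose_add, transpose_smul, Matrix.add_mul, Matrix.mul_add, Matrix.smul_mul,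
      Matrix.mul_smul, hV, hW, h, h', smul_smul, smul_zero, add_zero, zero_add]
    rw [← add_smul, e, one_smul]
  have hc : Continuous F := by
    have h1 : Continuous c := Complex.continuous_cos.comp (by fun_prop)
    have h2 : Continuous s := Complex.continuous_sin.comp (by fun_prop)
    fun_prop
  have hF0 : F 0 = V := by simp [F, c, s]
  have hF1 : F 1 = W := by
    have h1 : c 1 = 0 := by
      simp only [c, Set.Icc.coe_one, Complex.ofReal_one, one_mul, ← Complex.ofReal_cos,
        Real.cos_pi_div_two, Complex.ofReal_zero]
    have h2 : s 1 = 1 := by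
      simp only [s, Set.Icc.coe_one, Complex.ofReal_one, one_mul, ← Complex.ofReal_sin,
        Real.sin_pi_div_two]
    simp [F, h1, h2]
  refine ⟨⟨⟨⟨fun a => frameMap (F a.1) (hF a.1) a.2, ?_⟩, fun A => ?_, fun A => ?_⟩, ?_⟩⟩
  · refine Continuous.subtype_mk ?_ _
    fun_prop
  · simp only [hF0]
  · simp only [hF1]
  · intro t A hA
    obtain rfl : A = 1 := hA
    exact (frameMap_one (F t) (hF t)).trans (frameMap_one V hV).symm

theorem mul_list_sum_eq_zero {W : Matrix (Fin k) (Fin N) ℂ} (l : List (Matrix (Fin N) (Fin N) ℂ))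
    (h : ∀ M ∈ l, W * M = 0) : W * l.sum = 0 := by
  induction l with
  | nil => simp
  | cons M l ih =>
    rw [List.sum_cons, Matrix.mul_add, h M (by simp), ih fun M hM => h M (by simp [hM]), add_zero]

theorem coe_list_prod_frameMap {ι : Type*} (V : ι → Matrix (Fin N) (Fin k) ℂ)
    (hV : ∀ a, (V a)ᵀ * V a = 1) (l : List ι) (hl : l.Pairwise fun a b => (V a)ᵀ * V b = 0)
    (A : O k) :
    ((l.map fun a => frameMap (V a) (hV a)).prod A).1 =
      1 + (l.map fun a => V a * (A.1 - 1) * (V a)ᵀ).sum := by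
  induction l with
  | nil => simp
  | cons a l ih =>
    rw [List.pairwise_cons] at hl
    have h0 : (V a)ᵀ * (l.map fun b => V b * (A.1 - 1) * (V b)ᵀ).sum = 0 := by
      refine mul_list_sum_eq_zero _ ?_
      simp only [List.mem_map]
      rintro _ ⟨b, hb, rfl⟩
      rw [← Matrix.mul_assoc, ← Matrix.mul_assoc, hl.1 b hb, Matrix.zero_mul, Matrix.zero_mul]
    simp only [List.map_cons, List.prod_cons, List.sum_cons, ContinuousMap.mul_apply]
    rw [Submonoid.coe_mul, ih hl.2]
    change (1 + V a * (A.1 - 1) * (V a)ᵀ) * _ = _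
    rw [Matrix.mul_add, Matrix.mul_one, Matrix.add_mul, Matrix.one_mul,
      Matrix.mul_assoc _ (V a)ᵀ, h0, Matrix.mul_zero, add_zero, add_assoc]

/-- The frame which consists of the standard basis vectors indexed by `e`. -/
def coordFrame (e : Fin k → Fin N) : Matrix (Fin N) (Fin k) ℂ :=
  (1 : Matrix (Fin N) (Fin N) ℂ).submatrix id e

theorem transpose_coordFrame_mul (e f : Fin k → Fin N) :
    (coordFrame e)ᵀ * coordFrame f = (1 : Matrix (Fin N) (Fin N) ℂ).submatrix e f := by
  rw [coordFrame, coordFrame, transpose_submatrix, transpose_one,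
    ← submatrix_mul _ _ _ _ _ Function.bijective_id, Matrix.one_mul]

theorem transpose_coordFrame_mul_self (e : Fin k ↪ Fin N) :
    (coordFrame e)ᵀ * coordFrame e = 1 := by
  rw [transpose_coordFrame_mul, submatrix_one_embedding]

theorem transpose_coordFrame_mul_eq_zero {e f : Fin k → Fin N} (h : ∀ i j, e i ≠ f j) :
    (coordFrame e)ᵀ * coordFrame f = 0 := by
  ext i j
  simp [transpose_coordFrame_mul, h]

theorem coordFrame_conj_apply (e : Fin k → Fin N) (M : Matrix (Fin k) (Fin k) ℂ) (p q : Fin N) :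
    (coordFrame e * M * (coordFrame e)ᵀ) p q =
      ∑ i, ∑ j, if p = e i ∧ q = e j then M i j else 0 := by
  simp only [Matrix.mul_apply, coordFrame, submatrix_apply, transpose_apply, Matrix.one_apply, id,
    Finset.sum_mul]
  rw [Finset.sum_comm]
  refine Finset.sum_congr rfl fun i _ => Finset.sum_congr rfl fun j _ => ?_
  split_ifs <;> simp_all

theorem stabMap_eq_frameMap (h : k ≤ N) :
    stabMap h = frameMap (coordFrame (Fin.castLEEmb h))
      (transpose_coordFrame_mul_self (Fin.castLEEmb h)) := by
  have hl (i : Fin k) : blockEquiv h (Sum.inl i) = Fin.castLEEmb h i := by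
    ext
    simp [blockEquiv]
  have hr (r : Fin (N - k)) (i : Fin k) : blockEquiv h (Sum.inr r) ≠ Fin.castLE h i := by
    refine ne_of_ne_of_eq ?_ (hl i)
    simp
  ext A p q
  change reindex (blockEquiv h) (blockEquiv h) (fromBlocks A.1 0 0 1) p q =
    (1 + coordFrame (Fin.castLEEmb h) * (A.1 - 1) * (coordFrame (Fin.castLEEmb h))ᵀ :
      Matrix (Fin N) (Fin N) ℂ) p q
  rw [Matrix.add_apply, coordFrame_conj_apply]
  obtain ⟨p, rfl⟩ := (blockEquiv h).surjective p
  obtain ⟨q, rfl⟩ := (blockEquiv h).surjective q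
  rcases p with i | r <;> rcases q with j | s
  · simp only [hl, reindex_apply, submatrix_apply, EmbeddingLike.apply_eq_iff_eq]
    simp [← hl, ite_and, Matrix.one_apply]
  · simp [hr]
  · simp [hr]
  · simp [hr, Matrix.one_apply]

theorem map_frameMap_congr {i : ℕ} [Nonempty (Fin i)] {e f : Fin k ↪ Fin N}
    (h : ∀ a b, e a ≠ f b) (c : piO i k) :
    HomotopyGroup.map (Fin i) (frameMap (coordFrame e) (transpose_coordFrame_mul_self e))
        (frameMap_one _ _) c =
      HomotopyGroup.map (Fin i) (frameMap (coordFrame f) (transpose_coordFrame_mul_self f))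
        (frameMap_one _ _) c :=
  HomotopyGroup.map_eq_of_homotopicRel _ _ _
    (frameMap_homotopicRel _ _ (transpose_coordFrame_mul_eq_zero h)) c

/-- Embeddings of `Fin k` into `Fin N` are related by a chain of embeddings with disjoint images if
`N` is at least `3 * k`. -/
theorem map_frameMap_congr_of_le {i : ℕ} [Nonempty (Fin i)] (hN : 3 * k ≤ N)
    (e f : Fin k ↪ Fin N) (c : piO i k) :
    HomotopyGroup.map (Fin i) (frameMap (coordFrame e) (transpose_coordFrame_mul_self e))
        (frameMap_one _ _) c =
      HomotopyGroup.map (Fin i) (frameMap (coordFrame f) (transpose_coordFrame_mul_self f))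
        (frameMap_one _ _) c := by
  let S : Finset (Fin N) := (Finset.univ.map e ∪ Finset.univ.map f)ᶜ
  have hS : k ≤ S.card := by
    have h1 := Finset.card_union_le (Finset.univ.map e) (Finset.univ.map f)
    have h2 := Finset.card_compl (Finset.univ.map e ∪ Finset.univ.map f)
    simp only [Finset.card_map, Finset.card_univ, Fintype.card_fin] at h1
    rw [Fintype.card_fin] at h2
    simp only [S, h2]
    omega
  obtain ⟨g⟩ : Nonempty (Fin k ↪ S) :=
    Function.Embedding.nonempty_of_card_le (by simpa using hS)
  have hg (b : Fin k) : (g b : Fin N) ∉ Finset.univ.map e ∪ Finset.univ.map f :=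
    Finset.mem_compl.1 (g b).2
  simp only [Finset.mem_union, Finset.mem_map, Finset.mem_univ, true_and, not_or, not_exists]
    at hg
  let g' : Fin k ↪ Fin N := g.trans (Function.Embedding.subtype _)
  exact (map_frameMap_congr (f := g') (fun a b => (hg b).1 a) c).trans
    (map_frameMap_congr (f := g') (fun a b => (hg b).2 a) c).symm

/-- If `f A` consists of `r` disjoint copies of `A`, each of which induces the stabilization,
then `f` induces the `r`-th power of the stabilization. -/
theorem map_eq_stabO_pow {i r : ℕ} [Nonempty (Fin i)] (h : k ≤ N) (e : Fin r → Fin k ↪ Fin N)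
    (he : ∀ a b, a ≠ b → ∀ u v, e a u ≠ e b v) (f : C(O k, O N)) (hf1 : f 1 = 1)
    (hf : ∀ A, (f A).1 = 1 + ∑ a, coordFrame (e a) * (A.1 - 1) * (coordFrame (e a))ᵀ)
    (c : piO i k)
    (hc : ∀ a, HomotopyGroup.map (Fin i)
      (frameMap (coordFrame (e a)) (transpose_coordFrame_mul_self (e a))) (frameMap_one _ _) c =
        stabO i h c) :
    HomotopyGroup.map (Fin i) f hf1 c = stabO i h c ^ r := by
  let F (a : Fin r) := frameMap (coordFrame (e a)) (transpose_coordFrame_mul_self (e a))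
  obtain rfl : f = ((List.finRange r).map F).prod := by
    ext1 A
    refine Subtype.ext ?_
    rw [hf, coe_list_prod_frameMap, Fin.sum_univ_def]
    exact (List.nodup_finRange r).imp fun hab => transpose_coordFrame_mul_eq_zero (he _ _ hab)
  have := HomotopyGroup.map_list_prod (Fin i) (List.finRange r) F (fun a _ => frameMap_one _ _) hf1
    c (stabO i h c) fun a _ => hc a
  rwa [List.length_finRange] at this

variable (m n : ℕ)

theorem kron_one_one : kron (1 : O m) (1 : O n) = 1 := by
  refine Subtype.ext ?_
  change reindex _ _ ((1 : Matrix (Fin m) (Fin m) ℂ) ⊗ₖ (1 : Matrix (Fin n) (Fin n) ℂ)) = 1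
  simp

/-- The map `A ↦ A ⊗ 1`. -/
def kronLeft : C(O m, O (m * n)) :=
  ⟨fun A => kron A 1, (continuous_kron m n).comp (continuous_id.prodMk continuous_const)⟩

/-- The map `B ↦ 1 ⊗ B`. -/
def kronRight : C(O n, O (m * n)) :=
  ⟨fun B => kron 1 B, (continuous_kron m n).comp (continuous_const.prodMk continuous_id)⟩

theorem kronLeft_one : kronLeft m n 1 = 1 := kron_one_one m n

theorem kronRight_one : kronRight m n 1 = 1 := kron_one_one m n

variable {m n}

theorem kron_eq_mul (A : O m) (B : O n) : kron A B = kron A 1 * kron 1 B := by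
  refine Subtype.ext ?_
  change reindex _ _ (A.1 ⊗ₖ B.1) =
    reindex _ _ (A.1 ⊗ₖ (1 : Matrix (Fin n) (Fin n) ℂ)) *
      reindex _ _ ((1 : Matrix (Fin m) (Fin m) ℂ) ⊗ₖ B.1)
  simp only [reindex_apply]
  rw [submatrix_mul_equiv, ← mul_kronecker_mul, Matrix.mul_one, Matrix.one_mul]

variable (m) in
/-- The embedding `i ↦ (i, b)` of `Fin m` into `Fin (m * n)`. -/
def embLeft (b : Fin n) : Fin m ↪ Fin (m * n) :=
  ⟨fun i => finProdFinEquiv (i, b), fun i j h => by simpa using h⟩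

variable (n) in
/-- The embedding `j ↦ (a, j)` of `Fin n` into `Fin (m * n)`. -/
def embRight (a : Fin m) : Fin n ↪ Fin (m * n) :=
  ⟨fun j => finProdFinEquiv (a, j), fun i j h => by simpa using h⟩

@[simp]
theorem embLeft_apply (b : Fin n) (i : Fin m) : embLeft m b i = finProdFinEquiv (i, b) := rfl

@[simp]
theorem embRight_apply (a : Fin m) (j : Fin n) : embRight n a j = finProdFinEquiv (a, j) := rfl

theorem coe_kronLeft (A : O m) :
    (kronLeft m n A).1 = 1 + ∑ b : Fin n,
      coordFrame (embLeft m b) * (A.1 - 1) * (coordFrame (embLeft m b))ᵀ := by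
  ext p q
  obtain ⟨⟨i, b⟩, rfl⟩ := finProdFinEquiv.surjective p
  obtain ⟨⟨j, d⟩, rfl⟩ := finProdFinEquiv.surjective q
  rw [Matrix.add_apply, Matrix.sum_apply]
  simp only [coordFrame_conj_apply]
  simp only [kronLeft, kron, embLeft_apply, ContinuousMap.coe_mk,
    reindex_apply, submatrix_apply, Equiv.symm_apply_apply, kroneckerMap_apply,
    EmbeddingLike.apply_eq_iff_eq, Prod.mk.injEq, OneMemClass.coe_one, Matrix.one_apply,
    Matrix.sub_apply]
  by_cases hbd : b = d
  · subst hbd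
    simp [ite_and]
  · have (x : Fin n) (u v : Fin m) : ¬ ((i = u ∧ b = x) ∧ j = v ∧ d = x) := by
      rintro ⟨⟨-, rfl⟩, -, rfl⟩
      exact hbd rfl
    simp [this, hbd]

theorem coe_kronRight (B : O n) :
    (kronRight m n B).1 = 1 + ∑ a : Fin m,
      coordFrame (embRight n a) * (B.1 - 1) * (coordFrame (embRight n a))ᵀ := by
  ext p q
  obtain ⟨⟨i, b⟩, rfl⟩ := finProdFinEquiv.surjective p
  obtain ⟨⟨j, d⟩, rfl⟩ := finProdFinEquiv.surjective q
  rw [Matrix.add_apply, Matrix.sum_apply]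
  simp only [coordFrame_conj_apply]
  simp only [kronRight, kron, embRight_apply, ContinuousMap.coe_mk,
    reindex_apply, submatrix_apply, Equiv.symm_apply_apply, kroneckerMap_apply,
    EmbeddingLike.apply_eq_iff_eq, Prod.mk.injEq, OneMemClass.coe_one, Matrix.one_apply,
    Matrix.sub_apply]
  by_cases hij : i = j
  · subst hij
    simp [ite_and]
  · have (x : Fin m) (u v : Fin n) : ¬ ((i = x ∧ b = u) ∧ j = x ∧ d = v) := by
      rintro ⟨⟨rfl, -⟩, rfl, -⟩
      exact hij rfl
    simp [this, hij]

theorem embLeft_ne {b d : Fin n} (h : b ≠ d) (u v : Fin m) : embLeft m b u ≠ embLeft m d v := by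
  simp [h]

theorem embRight_ne {a b : Fin m} (h : a ≠ b) (u v : Fin n) : embRight n a u ≠ embRight n b v := by
  simp [h]

theorem map_kronLeft {i : ℕ} [Nonempty (Fin i)] (h : m ≤ m * n) (hn : Odd n) (c : piO i m) :
    HomotopyGroup.map (Fin i) (kronLeft m n) (kronLeft_one m n) c = stabO i h c ^ n := by
  refine map_eq_stabO_pow h (embLeft m) (fun _ _ hab => embLeft_ne hab) _ _ coe_kronLeft c
    fun b => ?_
  simp only [stabO, stabMap_eq_frameMap]
  obtain rfl | hn3 : n = 1 ∨ 3 ≤ n := by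
    obtain ⟨t, rfl⟩ := hn
    omega
  · have : embLeft m b = Fin.castLEEmb h := by
      ext u
      simp
    simp only [this]
  · exact map_frameMap_congr_of_le (by nlinarith) _ _ c

theorem map_kronRight {i : ℕ} [Nonempty (Fin i)] (h : n ≤ m * n) (c : piO i n) :
    HomotopyGroup.map (Fin i) (kronRight m n) (kronRight_one m n) c = stabO i h c ^ m := by
  refine map_eq_stabO_pow h (embRight n) (fun _ _ hab => embRight_ne hab) _ _ coe_kronRight c
    fun a => ?_
  simp only [stabO, stabMap_eq_frameMap]
  have h0 : embRight n (⟨0, a.pos⟩ : Fin m) = Fin.castLEEmb h := by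
    ext u
    simp
  simp only [← h0]
  by_cases ha : a = ⟨0, a.pos⟩
  · simp only [← ha]
  · exact map_frameMap_congr (embRight_ne ha) c

theorem tensorPi_quotPi (i : ℕ) [Nonempty (Fin i)] (x : piO i m) (y : piSO i n) :
    tensorPi i m n (quotPi i m x, y) =
      quotPi i (m * n) (HomotopyGroup.map (Fin i) (kronLeft m n) (kronLeft_one m n) x *
        HomotopyGroup.map (Fin i) (kronRight m n) (kronRight_one m n)
          (HomotopyGroup.map (Fin i) (incl n) rfl y)) := by
  let z := (HomotopyGroup.prodEquiv (Fin i) (1 : O m) (1 : SO n)).symm (x, y)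
  let f : C(O m × SO n, O (m * n)) := (kronLeft m n).comp ContinuousMap.fst
  let g : C(O m × SO n, O (m * n)) := ((kronRight m n).comp (incl n)).comp ContinuousMap.snd
  have hf : f (1, 1) = 1 := kronLeft_one m n
  have hg : g (1, 1) = 1 := kronRight_one m n
  have h1 : tensorPi i m n (quotPi i m x, y) =
      quotPi i (m * n) (HomotopyGroup.map (Fin i) (f * g) (by simp [hf, hg]) z) := by
    obtain ⟨p⟩ := x
    obtain ⟨q⟩ := y
    refine congrArg (Quotient.mk _) ?_
    ext t
    exact congrArg (quot (m * n)) (kron_eq_mul (p t) (incl n (q t)))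
  have h2 : HomotopyGroup.map (Fin i) f hf z =
      HomotopyGroup.map (Fin i) (kronLeft m n) (kronLeft_one m n) x := by
    obtain ⟨p⟩ := x
    obtain ⟨q⟩ := y
    rfl
  have h3 : HomotopyGroup.map (Fin i) g hg z =
      HomotopyGroup.map (Fin i) (kronRight m n) (kronRight_one m n)
          (HomotopyGroup.map (Fin i) (incl n) rfl y) := by
    obtain ⟨p⟩ := x
    obtain ⟨q⟩ := y
    rfl
  rw [h1, HomotopyGroup.map_mul_apply _ f g hf hg, h2, h3]

end ComplexOrthogonal

end
open ComplexOrthogonal in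
/-- Homotopy groups are written multiplicatively here, so that `n stab(x) + m stab(y)` reads
`stab(x) ^ n * stab(y) ^ m`. -/
theorem propositionP (m n i : ℕ) (hm : Even m) (hm0 : 0 < m) (hn : Odd n) (hi : 1 < i) :
    haveI : Nonempty (Fin i) := ⟨⟨0, Nat.zero_lt_of_lt hi⟩⟩
    Function.Bijective (quotPi i (m * n)) ∧
      ∃ hq : Function.Bijective (quotPi i m), ∀ (x : piPO i m) (y : piSO i n),
        tensorPi i m n (x, y) =
          stabPO i (Nat.le_mul_of_pos_right m hn.pos) hq x ^ n *
            stabSO i (Nat.le_mul_of_pos_left n hm0) y ^ m := by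
  have : Nontrivial (Fin i) := Fin.nontrivial_iff_two_le.2 hi
  refine ⟨quotPi_bijective i (m * n), quotPi_bijective i m, fun x y => ?_⟩
  obtain ⟨x, rfl⟩ := (quotPi_bijective i m).2 x
  have hx : stabPO i (Nat.le_mul_of_pos_right m hn.pos) (quotPi_bijective i m) (quotPi i m x) =
      quotPi i (m * n) (stabO i (Nat.le_mul_of_pos_right m hn.pos) x) :=
    congrArg (fun z => quotPi i (m * n) (stabO i (Nat.le_mul_of_pos_right m hn.pos) z))
      ((MulEquiv.ofBijective (quotPi i m) (quotPi_bijective i m)).symm_apply_apply x)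
  rw [hx, tensorPi_quotPi, map_kronLeft (Nat.le_mul_of_pos_right m hn.pos) hn,
    map_kronRight (Nat.le_mul_of_pos_left n hm0) (HomotopyGroup.map (Fin i) (incl n) rfl y), map_mul,
    map_pow, map_pow]
  rfl
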